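/- Let $m\ge 1$ and $0<p<1$, and put $q=1-p$ and $r=q/p$. Label the vertices of an $(m+1)$-gon clockwise by $0,1,\dots,m$, with labels read modulo $m+1$. A particle starts at vertex $0$ and at each step moves to an adjacent vertex, clockwise (from $j$ to $j+1$) with probability $p$ or counterclockwise (from $j$ to $j-1$) with probability $q$; the directions of successive moves are independent. Let $V$ be the number of moves needed to visit all vertices, that is, the least $n$ such that every vertex has been occupied at one of the times $0,1,\dots,n$. For $1\le i\le m$ let $L_i$ be the event that vertex $i$ is the last vertex to be visited, that is, that all vertices are visited and the first visit to $i$ comes after the first visit to every other vertex. Then for every $i=1,\dots,m$ the event $L_i$ has positive probability, and the conditional expectation $v_i=E[V\mid L_i]$ is finite and equals $$v_i=\begin{cases}\dfrac13(m-1)(m+1)+(m+1-i)\,i & \text{if } r=1,\\[2mm] \dfrac{r+1}{r-1}\left[m+i-1-\dfrac{2}{r-1}+\dfrac{2m}{r^m-1}-(m+1)\dfrac{r^i-1}{r^{m+1}-1}\right] & \text{if } r\ne 1.\end{cases}$$ Moreover $E[V]$ is finite and equals $$E[V]=\begin{cases}\dfrac{m(m+1)}{2} & \text{if } r=1,\\[2mm]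 \dfrac{r+1}{r-1}\left[m-\dfrac{1}{r-1}-\dfrac{m^2}{r^m-1}+\dfrac{(m+1)^2}{r^{m+1}-1}\right] & \text{if } r\ne 1.\end{cases}$$ (For $m=1$ the polygon degenerates to two vertices, and both kinds of move lead to the other vertex.) -/

import Mathlib

open MeasureTheory ProbabilityTheory
open scoped ENNReal

namespace PolygonWalk

variable {Ω : Type*}

/-- The vertex occupied after `n` moves by a particle that starts at vertex `0` of the
`(m + 1)`-gon. The vertices are labelled clockwise by `ZMod (m + 1)` (so `m + 1 = 0`), and the
`k`-th move is `ξ k`, with `1` for a clockwise and `-1` for a counterclockwise move. -/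
def position (m : ℕ) (ξ : ℕ → Ω → ℤ) (n : ℕ) (ω : Ω) : ZMod (m + 1) :=
  ((∑ k ∈ Finset.range n, ξ k ω : ℤ) : ZMod (m + 1))

/-- The number `V` of moves needed to visit all vertices: the least `n` such that every vertex is
occupied at one of the times `0, …, n` (and `⊤` if some vertex is never visited). -/
noncomputable def coverTime (m : ℕ) (ξ : ℕ → Ω → ℤ) (ω : Ω) : ℕ∞ :=
  ⨅ (n : ℕ) (_ : ∀ v : ZMod (m + 1), ∃ k ≤ n, position m ξ k ω = v), (n : ℕ∞)

/-- The event that `v` is the last vertex to be visited: at some time the particle is at `v` for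
the first time, having visited every other vertex before. -/
def lastVisited (m : ℕ) (ξ : ℕ → Ω → ℤ) (v : ZMod (m + 1)) : Set Ω :=
  {ω | ∃ n : ℕ, position m ξ n ω = v ∧ (∀ k < n, position m ξ k ω ≠ v) ∧
    ∀ w : ZMod (m + 1), w ≠ v → ∃ k < n, position m ξ k ω = w}

/-- The expectation of the cover time under `ν`, as an extended nonnegative real. -/
noncomputable def expectedCoverTime [MeasurableSpace Ω] (m : ℕ) (ξ : ℕ → Ω → ℤ)
    (ν : Measure Ω) : ℝ≥0∞ :=
  ∫⁻ ω, (coverTime m ξ ω : ℝ≥0∞) ∂ν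

end PolygonWalk

/-!
Fix the vertex `i` and lift the walk to `ℤ` so that it starts at the site `m - i`; then `i` lifts
to the sites `-1` and `m`, and its two neighbours to `0` and `m - 1`. A nearest-neighbour path skips
no site, so `i` is the last vertex visited exactly if the lifted walk visits both `0` and `m - 1`
before it leaves `{0, …, m - 1}`, and then the exit time is the cover time (`lastVisited_iff`).

It remains to find, for the walk stopped at the exit, the probability `h` of this event and the
expectation `g` of the exit time on it, as functions of the current site and of which of `0` and
`m - 1` have been visited. They are determined by the first-step equations
`h(y) = p h(y + 1) + q h(y - 1)` and `g(y) = h(y) + p g(y + 1) + q g(y - 1)`, the values at the exit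
and the agreement of the branches where a visit flag changes (`IsTourPair`). The equations make
`h` and `g + t h`, with `t` the number of moves made, harmonic for the stopped walk (`timed_eq`), so
their expectations are constant in time; as the exit time has an integrable bound, dominated
convergence identifies `P(L_i)` and `E[V; L_i]` with the values of `h` and `g` at the start
(`IsWalk.integral_limit`, `IsWalk.measure_lastVisited`).

The solutions are explicit: cubic polynomials in the site for `r = 1` (`isTourPair_sym`), and for
`r ≠ 1` combinations of `1`, `y`, `r ^ y` and `y r ^ y` (`isTourPair_exp`). The quotient `g / h` at the
start is the conditional expectation. The events `L_i` are disjoint and their probabilities, which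
are proportional to `r ^ (m - i)`, sum to `1`; hence `E[V]` is the sum of the values of `g`.
-/

namespace PolygonWalk

/-! ### Potentials for the stopped walk -/

section

variable {Ω : Type*}

/-- The state of the walk lifted to `ℤ` and stopped at its exit from `{0, …, m - 1}`: the number of
moves made, the current site, and whether the sites `0` and `m - 1` have been visited. -/
abbrev WalkState : Type := ℕ × ℤ × Bool × Bool

/-- The state after a move by `d`; a state whose site lies outside `{0, …, m - 1}` is frozen. -/
def step (m : ℕ) (s : WalkState) (d : ℤ) : WalkState :=
  if 0 ≤ s.2.1 ∧ s.2.1 < m then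
    (s.1 + 1, s.2.1 + d, s.2.2.1 || decide (s.2.1 + d = 0), s.2.2.2 || decide (s.2.1 + d = m - 1))
  else s

/-- The state after `n` moves of the walk that starts at the site `y`. -/
def chain (m : ℕ) (y : ℤ) (ξ : ℕ → Ω → ℤ) : ℕ → Ω → WalkState
  | 0, _ => (0, y, decide (y = 0), decide (y = m - 1))
  | n + 1, ω => step m (chain m y ξ n ω) (ξ n ω)

/-- The states that nearest-neighbour walks can reach: to get below `1` the walk visits `0`, and
to get above `m - 2` it visits `m - 1`. -/
structure IsReachable (m : ℕ) (s : WalkState) : Prop where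
  lower : -1 ≤ s.2.1
  upper : s.2.1 ≤ m
  left : s.2.1 ≤ 0 → s.2.2.1 = true
  right : m - 1 ≤ s.2.1 → s.2.2.2 = true

lemma IsReachable.step {m : ℕ} {s : WalkState} (hs : IsReachable m s) {d : ℤ}
    (hd : d = 1 ∨ d = -1) : IsReachable m (step m s d) := by
  obtain ⟨t, y, a, b⟩ := s
  obtain ⟨h1, h2, h3, h4⟩ := hs
  simp only at h1 h2 h3 h4
  unfold PolygonWalk.step
  split_ifs with h
  · simp only at h
    constructor
    · simp only; omega
    · simp only; omega
    · simp only [Bool.or_eq_true, decide_eq_true_eq]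
      intro h5
      by_cases h6 : y ≤ 0
      · exact Or.inl (h3 h6)
      · right; omega
    · simp only [Bool.or_eq_true, decide_eq_true_eq]
      intro h5
      by_cases h6 : (m : ℤ) - 1 ≤ y
      · exact Or.inl (h4 h6)
      · right; omega
  · exact ⟨h1, h2, h3, h4⟩

/-- A real function of the state of the walk, given by four functions of the site: which of them
applies depends on whether both the sites `0` and `m - 1`, only `0`, only `m - 1`, or neither has
been visited. -/
structure Potential where
  both : ℤ → ℝ
  left : ℤ → ℝ
  right : ℤ → ℝ
  none : ℤ → ℝ

/-- The value of a potential at a site with given visit flags. -/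
def Potential.eval (f : Potential) (y : ℤ) : Bool → Bool → ℝ
  | true, true => f.both y
  | true, false => f.left y
  | false, true => f.right y
  | false, false => f.none y

/-- The function `u` on `ℤ` satisfies the first-step equation with source `v`. -/
def FirstStep (p q : ℝ) (u v : ℤ → ℝ) : Prop :=
  ∀ y, u y = v y + p * u (y + 1) + q * u (y - 1)

/-- The potential `f` satisfies the first-step equations with source `s`, and its four parts agree
where a visit flag changes. -/
structure Potential.Solves (m : ℕ) (p q : ℝ) (f s : Potential) : Prop where
  both : FirstStep p q f.both s.both
  left : FirstStep p q f.left s.left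
  right : FirstStep p q f.right s.right
  none : FirstStep p q f.none s.none
  left_glue : f.left (m - 1) = f.both (m - 1)
  right_glue : f.right 0 = f.both 0
  none_left : f.none 0 = f.left 0
  none_right : f.none (m - 1) = f.right (m - 1)

/-- The function `g + t h` of the state, where `t` is the number of moves made. -/
def timed (g h : Potential) (s : WalkState) : ℝ :=
  g.eval s.2.1 s.2.2.1 s.2.2.2 + s.1 * h.eval s.2.1 s.2.2.1 s.2.2.2

lemma Potential.Solves.eval_eq {m : ℕ} {p q : ℝ} {f s : Potential} (hf : f.Solves m p q s)
    {t : ℕ} {y : ℤ} {a b : Bool} (hr : IsReachable m (t, y, a, b)) (h0 : 0 ≤ y) (hm : y < m) :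
    f.eval y a b = s.eval y a b +
      p * f.eval (y + 1) (a || decide (y + 1 = 0)) (b || decide (y + 1 = m - 1)) +
      q * f.eval (y + -1) (a || decide (y + -1 = 0)) (b || decide (y + -1 = m - 1)) := by
  obtain ⟨-, -, h3, h4⟩ := hr
  simp only at h3 h4
  rw [← sub_eq_add_neg y 1]
  have n1 : ¬ (y + 1 = 0) := by omega
  have n2 : ¬ (y - 1 = (m : ℤ) - 1) := by omega
  cases a <;> cases b <;>
    simp only [n1, n2, decide_false, Bool.or_false, Bool.true_or, Bool.false_or,
      Potential.eval, reduceCtorEq, imp_false] at h3 h4 ⊢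
  · rw [hf.none y]
    congr 2
    · by_cases h : y + 1 = (m : ℤ) - 1
      · simp only [h, decide_true, hf.none_right]
      · simp only [h, decide_false]
    · by_cases h : y - 1 = 0
      · simp only [h, decide_true, hf.none_left]
      · simp only [h, decide_false]
  · rw [hf.right y]
    congr 2
    by_cases h : y - 1 = 0
    · simp only [h, decide_true, hf.right_glue]
    · simp only [h, decide_false]
  · rw [hf.left y]
    congr 2
    by_cases h : y + 1 = (m : ℤ) - 1
    · simp only [h, decide_true, hf.left_glue]
    · simp only [h, decide_false]
  · exact hf.both y

/-- The zero potential. -/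
def Potential.zero : Potential := ⟨0, 0, 0, 0⟩

/-- If `h` is harmonic and `g` solves the first-step equations with source `h`, the weight `h` of
each move is paid for by the growth of `t` in `g + t h`. -/
lemma timed_eq {m : ℕ} {p q : ℝ} (hpq : p + q = 1) {g h : Potential} (hg : g.Solves m p q h)
    (hh : h.Solves m p q Potential.zero) {s : WalkState} (hs : IsReachable m s) :
    timed g h s = p * timed g h (step m s 1) + q * timed g h (step m s (-1)) := by
  obtain ⟨t, y, a, b⟩ := s
  unfold step
  by_cases hy : 0 ≤ y ∧ y < m
  · simp only [hy, and_self, if_true, timed]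
    have e1 := hg.eval_eq hs hy.1 hy.2
    have e2 := hh.eval_eq hs hy.1 hy.2
    have e3 : Potential.zero.eval y a b = 0 := by
      cases a <;> cases b <;> simp [Potential.eval, Potential.zero]
    rw [e3] at e2
    push_cast
    linear_combination e1 + (t + 1 : ℝ) * e2
  · simp only [hy, if_false]
    linear_combination (-timed g h (t, y, a, b)) * hpq

lemma Potential.exists_bound (f : Potential) (m : ℕ) :
    ∃ C, 0 ≤ C ∧ ∀ y : ℤ, -1 ≤ y → y ≤ m → ∀ a b, |f.eval y a b| ≤ C := by
  obtain ⟨C, hC⟩ := ((Set.finite_Icc (-1 : ℤ) m).prod (Set.finite_univ (α := Bool × Bool))).image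
    (fun x => |f.eval x.1 x.2.1 x.2.2|) |>.bddAbove
  refine ⟨max C 0, le_max_right _ _, fun y h1 h2 a b => le_max_of_le_left (hC ?_)⟩
  exact ⟨(y, a, b), ⟨⟨h1, h2⟩, trivial⟩, rfl⟩

lemma exists_timed_bound (g h : Potential) (m : ℕ) :
    ∃ C, 0 ≤ C ∧ ∀ s, IsReachable m s → |timed g h s| ≤ C * (1 + s.1) := by
  obtain ⟨C, hC0, hC⟩ := g.exists_bound m
  obtain ⟨C', hC0', hC'⟩ := h.exists_bound m
  refine ⟨C + C', by positivity, fun s hs => ?_⟩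
  have h1 := hC _ hs.lower hs.upper s.2.2.1 s.2.2.2
  have h2 := hC' _ hs.lower hs.upper s.2.2.1 s.2.2.2
  have h3 : (0 : ℝ) ≤ s.1 := by positivity
  have h4 := mul_le_mul_of_nonneg_left h2 h3
  have h5 := mul_nonneg hC0 h3
  unfold timed
  refine (abs_add_le _ _).trans ?_
  rw [abs_mul, abs_of_nonneg h3]
  nlinarith

end

/-! ### Optional stopping at the exit -/

section

variable {Ω : Type*}

lemma isReachable_chain {m : ℕ} {y : ℤ} (h0 : 0 ≤ y) (hm : y < m) {ξ : ℕ → Ω → ℤ} {ω : Ω}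
    (hξ : ∀ n, ξ n ω = 1 ∨ ξ n ω = -1) (n : ℕ) : IsReachable m (chain m y ξ n ω) := by
  induction n with
  | zero =>
    refine ⟨?_, ?_, ?_, ?_⟩ <;> simp only [chain, decide_eq_true_eq] <;> omega
  | succ n ih => exact ih.step (hξ n)

lemma chain_time_le (m : ℕ) (y : ℤ) (ξ : ℕ → Ω → ℤ) (ω : Ω) (n : ℕ) :
    (chain m y ξ n ω).1 ≤ n := by
  induction n with
  | zero => simp [chain]
  | succ n ih =>
    simp only [chain, step]
    split_ifs
    · dsimp only; omega
    · omega

lemma monotone_chain_time (m : ℕ) (y : ℤ) (ξ : ℕ → Ω → ℤ) (ω : Ω) :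
    Monotone fun n => (chain m y ξ n ω).1 := by
  refine monotone_nat_of_le_succ fun n => ?_
  simp only [chain, step]
  split_ifs <;> simp

lemma exists_chain_eq (m : ℕ) (y : ℤ) (ξ : ℕ → Ω → ℤ) (n : ℕ) :
    ∃ F : (Finset.range n → ℤ) → WalkState, ∀ ω, chain m y ξ n ω = F fun k => ξ k ω := by
  induction n with
  | zero => exact ⟨fun _ => (0, y, decide (y = 0), decide (y = m - 1)), fun _ => rfl⟩
  | succ n ih =>
    obtain ⟨F, hF⟩ := ih
    refine ⟨fun x => step m (F fun k => x ⟨k, ?_⟩) (x ⟨n, ?_⟩), fun ω => ?_⟩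
    · have := Finset.mem_range.1 k.2
      exact Finset.mem_range.2 (by omega)
    · exact Finset.mem_range.2 (by omega)
    · simp only [chain, hF]

variable [MeasurableSpace Ω] {μ : Measure Ω} {m : ℕ} {y : ℤ} {p q : ℝ} {ξ : ℕ → Ω → ℤ}

lemma measurable_chain (hmeas : ∀ n, Measurable (ξ n)) (n : ℕ) :
    Measurable (chain m y ξ n) := by
  obtain ⟨F, hF⟩ := exists_chain_eq m y ξ n
  have : chain m y ξ n = F ∘ fun ω (k : Finset.range n) => ξ k ω := funext hF
  rw [this]
  exact (Measurable.of_discrete (f := F)).comp (measurable_pi_lambda _ fun k => hmeas k)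

/-- The state after `n` moves depends on the first `n` moves only. -/
lemma indepFun_chain (hmeas : ∀ n, Measurable (ξ n)) (hindep : iIndepFun ξ μ) (n : ℕ) :
    IndepFun (chain m y ξ n) (ξ n) μ := by
  obtain ⟨F, hF⟩ := exists_chain_eq m y ξ n
  have h := hindep.indepFun_finset (Finset.range n) {n} (by simp) hmeas
  have hm : Measurable fun x : ({n} : Finset ℕ) → ℤ => x ⟨n, Finset.mem_singleton_self n⟩ :=
    measurable_pi_apply _
  have := h.comp (φ := F) Measurable.of_discrete hm
  have e : chain m y ξ n = F ∘ fun ω (k : Finset.range n) => ξ k ω := funext hF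
  rw [e]
  exact this

/-- The moves `ξ` are independent, each of them `1` with probability `p` and `-1` with probability
`q = 1 - p`. -/
structure IsWalk (μ : Measure Ω) (p q : ℝ) (ξ : ℕ → Ω → ℤ) : Prop where
  nonneg_left : 0 ≤ p
  nonneg_right : 0 ≤ q
  add_eq : p + q = 1
  meas : ∀ n, Measurable (ξ n)
  indep : iIndepFun ξ μ
  cw : ∀ n, μ {ω | ξ n ω = 1} = ENNReal.ofReal p
  ccw : ∀ n, μ {ω | ξ n ω = -1} = ENNReal.ofReal q

lemma IsWalk.ae_move [IsProbabilityMeasure μ] (h : IsWalk μ p q ξ) :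
    ∀ᵐ ω ∂μ, ∀ n, ξ n ω = 1 ∨ ξ n ω = -1 := by
  refine ae_all_iff.2 fun n => ?_
  have m1 : MeasurableSet {ω | ξ n ω = 1} := h.meas n (measurableSet_singleton 1)
  have m2 : MeasurableSet {ω | ξ n ω = -1} := h.meas n (measurableSet_singleton (-1))
  have hd : Disjoint {ω | ξ n ω = 1} {ω | ξ n ω = -1} := by
    rw [Set.disjoint_left]
    intro ω h1 h2
    simp only [Set.mem_ofPred_eq] at h1 h2
    omega
  have := measure_union hd m2 (μ := μ)
  rw [h.cw, h.ccw, ← ENNReal.ofReal_add h.nonneg_left h.nonneg_right, h.add_eq,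
    ENNReal.ofReal_one] at this
  exact (mem_ae_iff_prob_eq_one (m1.union m2)).2 this

lemma IsWalk.ae_reachable [IsProbabilityMeasure μ] (h : IsWalk μ p q ξ) (h0 : 0 ≤ y) (hm : y < m) :
    ∀ᵐ ω ∂μ, ∀ n, IsReachable m (chain m y ξ n ω) := by
  filter_upwards [h.ae_move] with ω hω n using isReachable_chain h0 hm hω n

/-- A function of the state that is harmonic at the reachable states has constant expectation. -/
lemma IsWalk.integral_chain [IsProbabilityMeasure μ] (hw : IsWalk μ p q ξ)
    (h0 : 0 ≤ y) (hm : y < m) {Φ : WalkState → ℝ} {C : ℝ} (hC0 : 0 ≤ C)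
    (hC : ∀ s, IsReachable m s → |Φ s| ≤ C * (1 + s.1))
    (hΦ : ∀ s, IsReachable m s → Φ s = p * Φ (step m s 1) + q * Φ (step m s (-1))) (n : ℕ) :
    Integrable (fun ω => Φ (chain m y ξ n ω)) μ ∧
      ∫ ω, Φ (chain m y ξ n ω) ∂μ = Φ (0, y, decide (y = 0), decide (y = m - 1)) := by
  have hmeasΦ : ∀ (Ψ : WalkState → ℝ) (n : ℕ), Measurable fun ω => Ψ (chain m y ξ n ω) :=
    fun Ψ n => (Measurable.of_discrete (f := Ψ)).comp (measurable_chain hw.meas n)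
  have hint : ∀ n, Integrable (fun ω => Φ (chain m y ξ n ω)) μ := by
    intro n
    refine Integrable.of_bound (hmeasΦ Φ n).aestronglyMeasurable (C * (1 + n)) ?_
    filter_upwards [hw.ae_reachable h0 hm] with ω hω
    refine (hC _ (hω n)).trans ?_
    have : ((chain m y ξ n ω).1 : ℝ) ≤ n := by exact_mod_cast chain_time_le m y ξ ω n
    gcongr
  -- At time `n + 1` the function is bounded by `C (n + 2)`, whatever the move.
  have hint' : ∀ (d : ℤ), (d = 1 ∨ d = -1) → ∀ n,
      Integrable (fun ω => Φ (step m (chain m y ξ n ω) d)) μ := by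
    intro d hd n
    refine Integrable.of_bound (hmeasΦ (fun s => Φ (step m s d)) n).aestronglyMeasurable
      (C * (1 + (n + 1))) ?_
    filter_upwards [hw.ae_reachable h0 hm] with ω hω
    refine (hC _ ((hω n).step hd)).trans ?_
    have h1 : (step m (chain m y ξ n ω) d).1 ≤ n + 1 := by
      have := chain_time_le m y ξ ω n
      unfold step
      split_ifs
      · dsimp only; omega
      · omega
    have : ((step m (chain m y ξ n ω) d).1 : ℝ) ≤ n + 1 := by exact_mod_cast h1
    gcongr
  refine ⟨hint n, ?_⟩
  induction n with
  | zero => simp [chain]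
  | succ n ih =>
    rw [← ih]
    have hprob : ∀ d : ℤ, ∫ ω, (if ξ n ω = d then (1 : ℝ) else 0) ∂μ =
        μ.real {ω | ξ n ω = d} := by
      intro d
      have hms : MeasurableSet {ω | ξ n ω = d} := hw.meas n (measurableSet_singleton d)
      rw [← integral_indicator_one hms]
      refine integral_congr_ae (ae_of_all _ fun ω => ?_)
      simp [Set.indicator_apply]
    have hprod : ∀ d : ℤ,
        ∫ ω, Φ (step m (chain m y ξ n ω) d) * (if ξ n ω = d then (1 : ℝ) else 0) ∂μ =
          (∫ ω, Φ (step m (chain m y ξ n ω) d) ∂μ) * μ.real {ω | ξ n ω = d} := by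
      intro d
      rw [← hprob]
      exact (indepFun_chain hw.meas hw.indep n).integral_fun_comp_mul_comp
        (f := fun s => Φ (step m s d)) (g := fun x => if x = d then (1 : ℝ) else 0)
        (measurable_chain hw.meas n).aemeasurable (hw.meas n).aemeasurable
        Measurable.of_discrete.aestronglyMeasurable Measurable.of_discrete.aestronglyMeasurable
    have hip : ∀ d : ℤ, (d = 1 ∨ d = -1) → Integrable
        (fun ω => Φ (step m (chain m y ξ n ω) d) * (if ξ n ω = d then (1 : ℝ) else 0)) μ := by
      intro d hd
      refine (hint' d hd n).mul_bdd (c := 1) ?_ (ae_of_all _ fun ω => ?_)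
      · exact ((Measurable.of_discrete (f := fun x : ℤ => if x = d then (1 : ℝ) else 0)).comp
          (hw.meas n)).aestronglyMeasurable
      · split_ifs <;> simp
    have hsplit : ∫ ω, Φ (chain m y ξ (n + 1) ω) ∂μ =
        ∫ ω, (Φ (step m (chain m y ξ n ω) 1) * (if ξ n ω = 1 then (1 : ℝ) else 0) +
          Φ (step m (chain m y ξ n ω) (-1)) * (if ξ n ω = -1 then (1 : ℝ) else 0)) ∂μ := by
      refine integral_congr_ae ?_
      filter_upwards [hw.ae_move] with ω hω
      rcases hω n with h | h <;> simp [chain, h]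
    have hp : μ.real {ω | ξ n ω = 1} = p := by
      rw [Measure.real, hw.cw, ENNReal.toReal_ofReal hw.nonneg_left]
    have hq : μ.real {ω | ξ n ω = -1} = q := by
      rw [Measure.real, hw.ccw, ENNReal.toReal_ofReal hw.nonneg_right]
    rw [hsplit, integral_add (hip 1 (Or.inl rfl)) (hip (-1) (Or.inr rfl)), hprod, hprod, hp, hq,
      ← integral_mul_const, ← integral_mul_const,
      ← integral_add ((hint' 1 (Or.inl rfl) n).mul_const p)
        ((hint' (-1) (Or.inr rfl) n).mul_const q)]
    refine integral_congr_ae ?_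
    filter_upwards [hw.ae_reachable h0 hm] with ω hω
    rw [hΦ _ (hω n)]
    ring

/-- The potential given by a function of the site alone, whatever the visit flags. -/
def Potential.uniform (u : ℤ → ℝ) : Potential := ⟨u, u, u, u⟩

lemma Potential.uniform_solves {u v : ℤ → ℝ} (h : FirstStep p q u v) :
    (Potential.uniform u).Solves m p q (Potential.uniform v) :=
  ⟨h, h, h, h, rfl, rfl, rfl, rfl⟩

/-- The exit time from `{0, …, m - 1}` is dominated by an integrable function: the expectation of
`D + t` is constant for a solution `D` of the first-step equation with source `1`. -/
lemma IsWalk.exists_integrable_time_bound [IsProbabilityMeasure μ] (hw : IsWalk μ p q ξ)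
    (h0 : 0 ≤ y) (hm : y < m) {D : ℤ → ℝ} (hD : FirstStep p q D 1) :
    ∃ T : Ω → ℝ, Integrable T μ ∧ ∀ᵐ ω ∂μ, ∀ n, ((chain m y ξ n ω).1 : ℝ) ≤ T ω := by
  have hone : (Potential.uniform 1).Solves m p q Potential.zero := by
    refine Potential.uniform_solves (v := 0) fun z => ?_
    simp [hw.add_eq]
  have hg := Potential.uniform_solves (m := m) hD
  have eu : ∀ (u : ℤ → ℝ) z a b, (Potential.uniform u).eval z a b = u z := by
    intro u z a b
    cases a <;> cases b <;> rfl
  obtain ⟨C, hC0, hC⟩ := exists_timed_bound (Potential.uniform D) (Potential.uniform 1) m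
  obtain ⟨C', hC0', hC'⟩ := (Potential.uniform D).exists_bound m
  have hmt : ∀ n, Measurable fun ω => ((chain m y ξ n ω).1 : ℝ≥0∞) := fun n =>
    (Measurable.of_discrete (f := fun s : WalkState => (s.1 : ℝ≥0∞))).comp
      (measurable_chain hw.meas n)
  have hbound : ∀ n, ∫⁻ ω, ((chain m y ξ n ω).1 : ℝ≥0∞) ∂μ ≤ ENNReal.ofReal (C' + C') := by
    intro n
    obtain ⟨i1, i2⟩ := hw.integral_chain h0 hm hC0 hC
      (fun s hs => timed_eq hw.add_eq hg hone hs) n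
    have hle : ∀ᵐ ω ∂μ, ((chain m y ξ n ω).1 : ℝ≥0∞) ≤ ENNReal.ofReal
        (timed (Potential.uniform D) (Potential.uniform 1) (chain m y ξ n ω) + C') := by
      filter_upwards [hw.ae_reachable h0 hm] with ω hω
      rw [← ENNReal.ofReal_natCast]
      apply ENNReal.ofReal_le_ofReal
      have := neg_le_of_abs_le (hC' _ (hω n).lower (hω n).upper (chain m y ξ n ω).2.2.1
        (chain m y ξ n ω).2.2.2)
      simp only [timed, eu, Pi.one_apply, mul_one] at this ⊢
      linarith
    have hnn : ∀ᵐ ω ∂μ, 0 ≤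
        timed (Potential.uniform D) (Potential.uniform 1) (chain m y ξ n ω) + C' := by
      filter_upwards [hw.ae_reachable h0 hm] with ω hω
      have := neg_le_of_abs_le (hC' _ (hω n).lower (hω n).upper (chain m y ξ n ω).2.2.1
        (chain m y ξ n ω).2.2.2)
      have h2 : (0 : ℝ) ≤ (chain m y ξ n ω).1 := by positivity
      simp only [timed, eu, Pi.one_apply, mul_one] at this ⊢
      linarith
    refine (lintegral_mono_ae hle).trans ?_
    have hi : Integrable (fun ω => timed (Potential.uniform D) (Potential.uniform 1)
        (chain m y ξ n ω) + C') μ := i1.add (integrable_const C')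
    rw [← ofReal_integral_eq_lintegral_ofReal hi hnn]
    apply ENNReal.ofReal_le_ofReal
    rw [integral_add i1 (integrable_const C'), i2, integral_const, probReal_univ, one_smul]
    have h3 := le_of_abs_le (hC' y (by omega) hm.le true true)
    simp only [timed, eu, Nat.cast_zero, zero_mul, add_zero] at h3 ⊢
    linarith
  have hsup : ∫⁻ ω, ⨆ n, ((chain m y ξ n ω).1 : ℝ≥0∞) ∂μ ≠ ∞ := by
    rw [lintegral_iSup hmt]
    · exact ne_top_of_le_ne_top ENNReal.ofReal_ne_top (iSup_le hbound)
    · intro a b hab ω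
      simp only [Nat.cast_le]
      exact monotone_chain_time m y ξ ω hab
  have hms : Measurable fun ω => ⨆ n, ((chain m y ξ n ω).1 : ℝ≥0∞) := Measurable.iSup hmt
  refine ⟨fun ω => (⨆ n, ((chain m y ξ n ω).1 : ℝ≥0∞)).toReal,
    integrable_toReal_of_lintegral_ne_top hms.aemeasurable hsup, ?_⟩
  filter_upwards [ae_lt_top hms hsup] with ω hω n
  rw [← ENNReal.toReal_natCast]
  exact ENNReal.toReal_mono hω.ne (le_iSup (fun n => ((chain m y ξ n ω).1 : ℝ≥0∞)) n)

/-- Optional stopping at the exit from `{0, …, m - 1}`. -/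
lemma IsWalk.integral_limit [IsProbabilityMeasure μ] (hw : IsWalk μ p q ξ)
    (h0 : 0 ≤ y) (hm : y < m) {D : ℤ → ℝ} (hD : FirstStep p q D 1) {g h : Potential}
    (hg : g.Solves m p q h) (hh : h.Solves m p q Potential.zero) {F : Ω → ℝ}
    (hF : ∀ᵐ ω ∂μ, ∀ᶠ n in Filter.atTop, timed g h (chain m y ξ n ω) = F ω) :
    Integrable F μ ∧
      ∫ ω, F ω ∂μ = timed g h (0, y, decide (y = 0), decide (y = m - 1)) := by
  obtain ⟨C, hC0, hC⟩ := exists_timed_bound g h m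
  obtain ⟨T, hTi, hT⟩ := hw.exists_integrable_time_bound h0 hm hD
  have hexp := hw.integral_chain h0 hm hC0 hC (fun s hs => timed_eq hw.add_eq hg hh hs)
  have hlim : ∀ᵐ ω ∂μ, Filter.Tendsto (fun n => timed g h (chain m y ξ n ω)) Filter.atTop
      (nhds (F ω)) := by
    filter_upwards [hF] with ω hω
    exact tendsto_const_nhds.congr' (hω.mono fun n hn => hn.symm)
  have hb : ∀ n, ∀ᵐ ω ∂μ, ‖timed g h (chain m y ξ n ω)‖ ≤ C * (1 + T ω) := by
    intro n
    filter_upwards [hw.ae_reachable h0 hm, hT] with ω h1 h2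
    refine (hC _ (h1 n)).trans ?_
    have := h2 n
    gcongr
  have hbi : Integrable (fun ω => C * (1 + T ω)) μ :=
    ((integrable_const (1 : ℝ)).add hTi).const_mul C
  have hconv := tendsto_integral_of_dominated_convergence _
    (fun n => (hexp n).1.aestronglyMeasurable) hbi hb hlim
  refine ⟨?_, ?_⟩
  · refine hbi.mono' (aestronglyMeasurable_of_tendsto_ae Filter.atTop
      (fun n => (hexp n).1.aestronglyMeasurable) hlim) ?_
    filter_upwards [hlim, ae_all_iff.2 hb] with ω h1 h2
    exact le_of_tendsto h1.norm (Filter.Eventually.of_forall h2)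
  · simp only [(hexp _).2] at hconv
    exact tendsto_nhds_unique tendsto_const_nhds hconv |>.symm

end

/-! ### Paths on the polygon and their lifts -/

section

variable {Ω : Type*}

/-- The site after `n` moves of the unstopped walk on `ℤ` that starts at `y`. -/
def site (y : ℤ) (ξ : ℕ → Ω → ℤ) (ω : Ω) (n : ℕ) : ℤ := y + ∑ k ∈ Finset.range n, ξ k ω

lemma site_succ (y : ℤ) (ξ : ℕ → Ω → ℤ) (ω : Ω) (n : ℕ) :
    site y ξ ω (n + 1) = site y ξ ω n + ξ n ω := by
  simp [site, Finset.sum_range_succ, add_assoc]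

lemma exists_le_succ {P : ℕ → Prop} {n : ℕ} :
    (∃ k ≤ n + 1, P k) ↔ (∃ k ≤ n, P k) ∨ P (n + 1) := by
  constructor
  · rintro ⟨k, hk, h⟩
    rcases Nat.lt_or_ge n k with h1 | h1
    · obtain rfl : k = n + 1 := by omega
      exact Or.inr h
    · exact Or.inl ⟨k, h1, h⟩
  · rintro (⟨k, hk, h⟩ | h)
    · exact ⟨k, by omega, h⟩
    · exact ⟨n + 1, le_rfl, h⟩

open Classical in
/-- Up to the exit from `{0, …, m - 1}` the chain records the number of moves, the site, and the
visits to `0` and `m - 1`. -/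
lemma chain_eq {m : ℕ} {y : ℤ} {ξ : ℕ → Ω → ℤ} {ω : Ω} {n : ℕ}
    (h : ∀ k < n, 0 ≤ site y ξ ω k ∧ site y ξ ω k < m) :
    chain m y ξ n ω = (n, site y ξ ω n, decide (∃ k ≤ n, site y ξ ω k = 0),
      decide (∃ k ≤ n, site y ξ ω k = m - 1)) := by
  induction n with
  | zero => simp [chain, site]
  | succ n ih =>
    have hn := h n (Nat.lt_succ_self n)
    rw [chain, ih fun k hk => h k (by omega), step]
    simp only [hn, and_self, if_true, ← site_succ, exists_le_succ, Bool.decide_or]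

lemma chain_eq_of_exit {m : ℕ} {y : ℤ} {ξ : ℕ → Ω → ℤ} {ω : Ω} {n : ℕ}
    (h : ¬ (0 ≤ (chain m y ξ n ω).2.1 ∧ (chain m y ξ n ω).2.1 < m)) {k : ℕ} (hk : n ≤ k) :
    chain m y ξ k ω = chain m y ξ n ω := by
  induction k, hk using Nat.le_induction with
  | base => rfl
  | succ k hk ih => rw [chain, ih, step, if_neg h]

lemma exists_exit {m : ℕ} {y : ℤ} {ξ : ℕ → Ω → ℤ} {ω : Ω} {T : ℝ}
    (hT : ∀ n, ((chain m y ξ n ω).1 : ℝ) ≤ T) :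
    ∃ n, (∀ k < n, 0 ≤ site y ξ ω k ∧ site y ξ ω k < m) ∧
      ¬ (0 ≤ site y ξ ω n ∧ site y ξ ω n < m) := by
  by_cases h : ∃ n, ¬ (0 ≤ site y ξ ω n ∧ site y ξ ω n < m)
  · classical
    exact ⟨Nat.find h, fun k hk => not_not.1 (Nat.find_min h hk), Nat.find_spec h⟩
  · push Not at h
    obtain ⟨n, hn⟩ := exists_nat_gt T
    have := hT n
    rw [chain_eq fun k _ => h k] at this
    exact absurd this (not_le.2 hn)

/-- A nearest-neighbour path on `ℤ` does not skip a site. -/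
lemma exists_eq_of_between {f : ℕ → ℤ} (hf : ∀ n, f (n + 1) - f n = 1 ∨ f (n + 1) - f n = -1)
    {a b : ℕ} (hab : a ≤ b) {z : ℤ} (h : f a ≤ z ∧ z ≤ f b ∨ f b ≤ z ∧ z ≤ f a) :
    ∃ k ≤ b, f k = z := by
  induction b, hab using Nat.le_induction with
  | base => exact ⟨a, le_rfl, by omega⟩
  | succ b hb ih =>
    by_cases hz : f (b + 1) = z
    · exact ⟨b + 1, le_rfl, hz⟩
    · obtain ⟨k, hk, e⟩ := ih (by have := hf b; omega)
      exact ⟨k, by omega, e⟩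

lemma position_eq_iff (m : ℕ) (y : ℤ) (ξ : ℕ → Ω → ℤ) (ω : Ω) (n : ℕ) (z : ℤ) :
    position m ξ n ω = (z : ZMod (m + 1)) ↔ ((m : ℤ) + 1) ∣ site y ξ ω n - y - z := by
  rw [position, ZMod.intCast_eq_intCast_iff_dvd_sub, dvd_sub_comm, site]
  push_cast
  rw [add_sub_cancel_left]

/-- At its last new vertex the walk has just finished the tour. -/
lemma coverTime_eq {m : ℕ} {ξ : ℕ → Ω → ℤ} {ω : Ω} {v : ZMod (m + 1)} {n : ℕ}
    (h1 : position m ξ n ω = v) (h2 : ∀ k < n, position m ξ k ω ≠ v)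
    (h3 : ∀ w : ZMod (m + 1), w ≠ v → ∃ k < n, position m ξ k ω = w) :
    coverTime m ξ ω = n := by
  refine le_antisymm (iInf₂_le n fun w => ?_) (le_iInf₂ fun k hk => ?_)
  · by_cases hw : w = v
    · exact ⟨n, le_rfl, hw ▸ h1⟩
    · obtain ⟨k, hk, e⟩ := h3 w hw
      exact ⟨k, hk.le, e⟩
  · obtain ⟨j, hj, e⟩ := hk v
    have : n ≤ j := not_lt.1 fun h => h2 j h e
    exact_mod_cast this.trans hj

lemma disjoint_lastVisited {m : ℕ} (ξ : ℕ → Ω → ℤ) {v w : ZMod (m + 1)} (h : v ≠ w) :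
    Disjoint (lastVisited m ξ v) (lastVisited m ξ w) := by
  rw [Set.disjoint_left]
  rintro ω ⟨n, h1, h2, h3⟩ ⟨n', h1', h2', h3'⟩
  obtain ⟨k, hk, e⟩ := h3 w h.symm
  obtain ⟨k', hk', e'⟩ := h3' v h
  have a1 : n' ≤ k := not_lt.1 fun h => h2' k h e
  have a2 : n ≤ k' := not_lt.1 fun h => h2 k' h e'
  omega

lemma measurableSet_lastVisited [MeasurableSpace Ω] {m : ℕ} {ξ : ℕ → Ω → ℤ}
    (hmeas : ∀ n, Measurable (ξ n)) (v : ZMod (m + 1)) : MeasurableSet (lastVisited m ξ v) := by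
  have hpos : ∀ n (w : ZMod (m + 1)), MeasurableSet {ω | position m ξ n ω = w} := by
    intro n w
    have hs : Measurable fun ω => ∑ k ∈ Finset.range n, ξ k ω :=
      Finset.measurable_sum _ fun k _ => hmeas k
    exact hs (MeasurableSet.of_discrete (s := {z : ℤ | (z : ZMod (m + 1)) = w}))
  have : lastVisited m ξ v = ⋃ n, ({ω | position m ξ n ω = v} ∩
      (⋂ k, ⋂ (_ : k < n), {ω | position m ξ k ω = v}ᶜ) ∩
      ⋂ w : ZMod (m + 1), ⋂ (_ : w ≠ v), ⋃ k, ⋃ (_ : k < n), {ω | position m ξ k ω = w}) := by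
    ext ω
    simp [lastVisited, and_assoc]
  rw [this]
  refine MeasurableSet.iUnion fun n => ((hpos n v).inter ?_).inter ?_
  · exact MeasurableSet.iInter fun k => MeasurableSet.iInter fun _ => (hpos k v).compl
  · exact MeasurableSet.iInter fun w => MeasurableSet.iInter fun _ =>
      MeasurableSet.iUnion fun k => MeasurableSet.iUnion fun _ => hpos k w

/-- Lift the walk so that vertex `i` corresponds to the sites `-1` and `m`; the start `0` becomes
the site `m - i`. Then `i` is the last vertex exactly if both `0` and `m - 1`, which lift the
neighbours of `i`, are visited before the exit from `{0, …, m - 1}`, and the exit time is the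
cover time. -/
lemma lastVisited_iff {m i : ℕ} (hi : 1 ≤ i) (him : i ≤ m) {ξ : ℕ → Ω → ℤ} {ω : Ω}
    (hξ : ∀ n, ξ n ω = 1 ∨ ξ n ω = -1) {n : ℕ}
    (h : ∀ k < n, 0 ≤ site (m - i) ξ ω k ∧ site (m - i) ξ ω k < m)
    (hn : ¬ (0 ≤ site (m - i) ξ ω n ∧ site (m - i) ξ ω n < m)) :
    (ω ∈ lastVisited m ξ (i : ZMod (m + 1)) ↔
      (∃ k ≤ n, site (m - i) ξ ω k = 0) ∧ ∃ k ≤ n, site (m - i) ξ ω k = m - 1) ∧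
    (ω ∈ lastVisited m ξ (i : ZMod (m + 1)) → coverTime m ξ ω = n) := by
  set Y := site (m - i) ξ ω with hY
  have hstep : ∀ k, Y (k + 1) - Y k = 1 ∨ Y (k + 1) - Y k = -1 := by
    intro k
    rw [hY, site_succ, add_sub_cancel_left]
    exact hξ k
  have hpos : ∀ k (z : ℤ), position m ξ k ω = (z : ZMod (m + 1)) ↔
      ((m : ℤ) + 1) ∣ Y k - (m - i) - z := fun k z => position_eq_iff m _ ξ ω k z
  have hcast : ((i : ℕ) : ZMod (m + 1)) = ((i : ℤ) : ZMod (m + 1)) := by push_cast; rfl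
  have hY0 : Y 0 = m - i := by simp [hY, site]
  have hexit : Y n = -1 ∨ Y n = m := by
    rcases n with _ | n
    · omega
    · have := h n (Nat.lt_succ_self n)
      have := hstep n
      omega
  have hni : position m ξ n ω = (i : ZMod (m + 1)) := by
    rw [hcast, hpos]
    rcases hexit with e | e <;> rw [e]
    · exact ⟨-1, by ring⟩
    · exact ⟨0, by ring⟩
  have hki : ∀ k < n, position m ξ k ω ≠ (i : ZMod (m + 1)) := by
    intro k hk
    rw [hcast, Ne, hpos]
    rintro ⟨c, hc⟩
    have hb := h k hk
    have c0 : c < 0 := by by_contra hcn; nlinarith [not_lt.1 hcn]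
    have c1 : -1 < c := by by_contra hcn; nlinarith [not_lt.1 hcn]
    omega
  have hlast : ω ∈ lastVisited m ξ (i : ZMod (m + 1)) ↔
      ∀ w : ZMod (m + 1), w ≠ (i : ZMod (m + 1)) → ∃ k < n, position m ξ k ω = w := by
    constructor
    · rintro ⟨n', h1, h2, h3⟩
      have e1 : n ≤ n' := not_lt.1 fun hlt => hki _ hlt h1
      have e2 : n' ≤ n := not_lt.1 fun hlt => h2 _ hlt hni
      obtain rfl : n = n' := le_antisymm e1 e2
      exact h3
    · exact fun h3 => ⟨n, hni, hki, h3⟩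
  refine ⟨?_, fun hL => coverTime_eq hni hki (hlast.1 hL)⟩
  rw [hlast]
  have hone : (1 : ZMod (m + 1)) ≠ 0 := by
    have : Fact (1 < m + 1) := ⟨by omega⟩
    exact one_ne_zero
  constructor
  · intro hw
    constructor
    · obtain ⟨k, hk, e⟩ := hw (((i + 1 : ℤ)) : ZMod (m + 1)) (by
        push_cast
        simpa using hone)
      rw [hpos] at e
      obtain ⟨c, hc⟩ := e
      have hb := h k hk
      have c0 : c < 0 := by by_contra hcn; nlinarith [not_lt.1 hcn]
      have c1 : -2 < c := by by_contra hcn; nlinarith [not_lt.1 hcn]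
      obtain rfl : c = -1 := by omega
      exact ⟨k, hk.le, by linarith⟩
    · obtain ⟨k, hk, e⟩ := hw (((i - 1 : ℤ)) : ZMod (m + 1)) (by
        push_cast
        simpa using hone)
      rw [hpos] at e
      obtain ⟨c, hc⟩ := e
      have hb := h k hk
      have c0 : c < 1 := by by_contra hcn; nlinarith [not_lt.1 hcn]
      have c1 : -1 < c := by by_contra hcn; nlinarith [not_lt.1 hcn]
      obtain rfl : c = 0 := by omega
      exact ⟨k, hk.le, by linarith⟩
  · rintro ⟨⟨a, ha, ea⟩, ⟨b, hb, eb⟩⟩ w hwi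
    -- The site in `{0, …, m}` that lifts `w`; it is not `m`, which lifts `i`.
    set z : ℤ := ((w.val : ℤ) - i - 1) % (m + 1) with hz
    have hz0 : 0 ≤ z := Int.emod_nonneg _ (by omega)
    have hz1 : z < m + 1 := Int.emod_lt_of_pos _ (by omega)
    have hdiv := Int.mul_ediv_add_emod ((w.val : ℤ) - i - 1) (m + 1)
    rw [← hz] at hdiv
    have hwv : w = ((w.val : ℤ) : ZMod (m + 1)) := by simp
    have hzm : z ≠ m := by
      intro e
      apply hwi
      rw [hwv, hcast, ZMod.intCast_eq_intCast_iff_dvd_sub]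
      push_cast
      refine ⟨-(((w.val : ℤ) - i - 1) / (m + 1)) - 1, ?_⟩
      rw [e] at hdiv
      linear_combination hdiv
    have hkz : ∃ k ≤ n, Y k = z := by
      rcases le_total a b with hab | hab
      · obtain ⟨k, hk, e⟩ := exists_eq_of_between hstep hab (z := z) (Or.inl (by omega))
        exact ⟨k, hk.trans hb, e⟩
      · obtain ⟨k, hk, e⟩ := exists_eq_of_between hstep hab (z := z) (Or.inr (by omega))
        exact ⟨k, hk.trans ha, e⟩
    obtain ⟨k, hk, e⟩ := hkz
    have hkn : k ≠ n := by
      rintro rfl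
      omega
    refine ⟨k, by omega, ?_⟩
    rw [hwv, hpos, e]
    refine ⟨-(((w.val : ℤ) - i - 1) / (m + 1)) - 1, ?_⟩
    linear_combination hdiv

end

/-! ### The probability of a last vertex and the cover time on it -/

section

variable {Ω : Type*}

/-- The equations and exit values that determine, as functions of the state, the probability `h` of
visiting both `0` and `m - 1` before the exit from `{0, …, m - 1}`, and the expectation `g` of the
exit time on that event. -/
structure IsTourPair (m : ℕ) (p q : ℝ) (h g : Potential) : Prop where
  harmonic : h.Solves m p q Potential.zero
  solves : g.Solves m p q h
  both_eq_one : h.both = 1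
  left_low : h.left (-1) = 0
  right_high : h.right m = 0
  time_both_low : g.both (-1) = 0
  time_both_high : g.both m = 0
  time_left_low : g.left (-1) = 0
  time_right_high : g.right m = 0

/-- The start value is that of the branch `none`, also if the walk starts at `0` or `m - 1`: the
branches agree there. -/
lemma Potential.Solves.eval_start {m : ℕ} {p q : ℝ} {f s : Potential} (hf : f.Solves m p q s)
    (y : ℤ) : f.eval y (decide (y = 0)) (decide (y = m - 1)) = f.none y := by
  by_cases h0 : y = 0 <;> by_cases h1 : y = (m : ℤ) - 1
  · have h2 : (m : ℤ) - 1 = 0 := h1.symm.trans h0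
    have := hf.left_glue
    simp only [h0, h2, decide_true, Potential.eval] at this ⊢
    rw [hf.none_left, this]
  · rw [decide_eq_true h0, decide_eq_false h1, h0]
    exact hf.none_left.symm
  · rw [decide_eq_false h0, decide_eq_true h1, h1]
    exact hf.none_right.symm
  · rw [decide_eq_false h0, decide_eq_false h1]
    rfl

lemma Potential.zero_eval (y : ℤ) (a b : Bool) : Potential.zero.eval y a b = 0 := by
  cases a <;> cases b <;> rfl

lemma Potential.zero_solves (m : ℕ) (p q : ℝ) :
    Potential.zero.Solves m p q Potential.zero := by
  constructor <;> simp [FirstStep, Potential.zero]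

/-- At the exit, `h` is the indicator that both visits were made, and `g` vanishes. -/
lemma IsTourPair.eval_exit {m : ℕ} {p q : ℝ} {h g : Potential} (H : IsTourPair m p q h g)
    {s : WalkState} (hs : IsReachable m s) (hx : ¬ (0 ≤ s.2.1 ∧ s.2.1 < m)) :
    h.eval s.2.1 s.2.2.1 s.2.2.2 = (if s.2.2.1 = true ∧ s.2.2.2 = true then 1 else 0) ∧
      g.eval s.2.1 s.2.2.1 s.2.2.2 = 0 := by
  obtain ⟨t, y, a, b⟩ := s
  obtain ⟨h1, h2, h3, h4⟩ := hs
  simp only at h1 h2 h3 h4 hx ⊢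
  have hy : y = -1 ∨ y = m := by omega
  rcases hy with rfl | rfl
  · obtain rfl := h3 (by omega)
    cases b <;> simp [Potential.eval, H.both_eq_one, H.left_low, H.time_left_low,
      H.time_both_low]
  · obtain rfl := h4 (by omega)
    cases a <;> simp [Potential.eval, H.both_eq_one, H.right_high, H.time_right_high,
      H.time_both_high]

variable [MeasurableSpace Ω] {μ : Measure Ω} {m : ℕ} {p q : ℝ} {ξ : ℕ → Ω → ℤ}

lemma IsWalk.measure_lastVisited [IsProbabilityMeasure μ] (hw : IsWalk μ p q ξ)
    {h g : Potential} (H : IsTourPair m p q h g) {i : ℕ} (hi : 1 ≤ i) (him : i ≤ m) :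
    μ (lastVisited m ξ (i : ZMod (m + 1))) = ENNReal.ofReal (h.none (m - i)) ∧
    ∫⁻ ω in lastVisited m ξ (i : ZMod (m + 1)), (coverTime m ξ ω : ℝ≥0∞) ∂μ =
      ENNReal.ofReal (g.none (m - i)) ∧ 0 ≤ g.none (m - i) := by
  classical
  set L := lastVisited m ξ (i : ZMod (m + 1)) with hLdef
  have hLm : MeasurableSet L := measurableSet_lastVisited hw.meas _
  have h0 : (0 : ℤ) ≤ m - i := by omega
  have hm : (m : ℤ) - i < m := by omega
  have hD : FirstStep p q g.both 1 := H.both_eq_one ▸ H.solves.both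
  obtain ⟨T, -, hT⟩ := hw.exists_integrable_time_bound h0 hm hD
  have hexit : ∀ᵐ ω ∂μ, ∃ n : ℕ, (∀ k ≥ n, chain m (m - i) ξ k ω = chain m (m - i) ξ n ω) ∧
      (chain m (m - i) ξ n ω).1 = n ∧ (ω ∈ L → coverTime m ξ ω = n) ∧
      h.eval (chain m (m - i) ξ n ω).2.1 (chain m (m - i) ξ n ω).2.2.1
        (chain m (m - i) ξ n ω).2.2.2 = (if ω ∈ L then 1 else 0) ∧
      g.eval (chain m (m - i) ξ n ω).2.1 (chain m (m - i) ξ n ω).2.2.1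
        (chain m (m - i) ξ n ω).2.2.2 = 0 := by
    filter_upwards [hw.ae_move, hw.ae_reachable h0 hm, hT] with ω h1 h2 h3
    obtain ⟨n, hn, hx⟩ := exists_exit h3
    obtain ⟨l1, l2⟩ := lastVisited_iff hi him h1 hn hx
    have hc := chain_eq hn
    have hx' : ¬ (0 ≤ (chain m (m - i) ξ n ω).2.1 ∧ (chain m (m - i) ξ n ω).2.1 < m) := by
      rw [hc]; exact hx
    refine ⟨n, fun k hk => chain_eq_of_exit hx' hk, by rw [hc], l2, ?_, ?_⟩
    · rw [(H.eval_exit (h2 n) hx').1, hc]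
      simp only [decide_eq_true_eq, ← l1, ← hLdef]
    · exact (H.eval_exit (h2 n) hx').2
  obtain ⟨-, e1⟩ := hw.integral_limit h0 hm hD (F := L.indicator 1) H.harmonic
    (Potential.zero_solves m p q) (by
      filter_upwards [hexit] with ω ⟨n, hn, _, _, hh, _⟩
      filter_upwards [Filter.eventually_ge_atTop n] with k hk
      rw [hn k hk, timed, hh, Potential.zero_eval, mul_zero, add_zero, Set.indicator_apply]
      simp)
  obtain ⟨i2, e2⟩ := hw.integral_limit h0 hm hD
    (F := L.indicator fun ω => ((coverTime m ξ ω).toNat : ℝ)) H.solves H.harmonic (by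
      filter_upwards [hexit] with ω ⟨n, hn, ht, hc, hh, hg⟩
      filter_upwards [Filter.eventually_ge_atTop n] with k hk
      rw [hn k hk, timed, hh, hg, ht, Set.indicator_apply]
      by_cases hω : ω ∈ L
      · simp [hω, hc hω]
      · simp [hω])
  have hnn : ∀ ω, 0 ≤ L.indicator (fun ω => ((coverTime m ξ ω).toNat : ℝ)) ω := fun ω =>
    Set.indicator_nonneg (fun _ _ => Nat.cast_nonneg _) ω
  simp only [timed, Nat.cast_zero, zero_mul, add_zero] at e1 e2
  rw [H.harmonic.eval_start] at e1
  rw [H.solves.eval_start] at e2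
  refine ⟨?_, ?_, ?_⟩
  · rw [← e1, integral_indicator_one hLm, Measure.real, ENNReal.ofReal_toReal (measure_ne_top _ _)]
  · rw [← e2, ofReal_integral_eq_lintegral_ofReal i2 (ae_of_all _ hnn), ← lintegral_indicator hLm]
    refine lintegral_congr_ae ?_
    filter_upwards [hexit] with ω ⟨n, hn, ht, hc, hh, hg⟩
    rw [Set.indicator_apply, Set.indicator_apply]
    split_ifs with hω
    · simp [hc hω]
    · simp
  · rw [← e2]
    exact integral_nonneg hnn

end

/-! ### Explicit solutions of the first-step equations -/

section

variable {m : ℕ} {p q : ℝ}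

/-- The first-step equation for polynomials with exponential weights, away from `r = 1`. -/
lemma firstStep_exp {r : ℝ} (hr : 0 < r) (a b c d : ℝ) :
    FirstStep (1 / (r + 1)) (r / (r + 1)) (fun y : ℤ => a + b * y + (c + d * y) * r ^ y)
      (fun y : ℤ => (r - 1) / (r + 1) * (b - d * r ^ y)) := by
  intro y
  have h : r + 1 ≠ 0 := by positivity
  simp only [zpow_add_one₀ hr.ne', zpow_sub_one₀ hr.ne']
  push_cast
  field_simp
  ring

/-- The first-step equation for cubic polynomials and the symmetric walk. -/
lemma firstStep_cubic (a b c d : ℝ) :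
    FirstStep (1 / 2) (1 / 2) (fun y : ℤ => a + b * y + c * y ^ 2 + d * y ^ 3)
      (fun y : ℤ => -c - 3 * d * y) := by
  intro y
  push_cast
  ring

lemma FirstStep.congr {u v u' v' : ℤ → ℝ} (h : FirstStep p q u v) (hu : ∀ y, u' y = u y)
    (hv : ∀ y, v' y = v y) : FirstStep p q u' v' := by
  intro y
  rw [hu, hu, hu, hv]
  exact h y

/-- The probability of the tour for the symmetric walk. -/
noncomputable def symProb (m : ℕ) : Potential where
  both := 1
  left y := (y + 1) / m
  right y := (m - y) / m
  none _ := 1 / m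

/-- The expectation of the exit time on the event of the tour for the symmetric walk. -/
noncomputable def symTime (m : ℕ) : Potential where
  both y := (y + 1) * (m - y)
  left y := (y + 1) * (1 + m / 3) - (y + 1) ^ 3 / (3 * m)
  right y := (m - y) * (1 + m / 3) - (m - y) ^ 3 / (3 * m)
  none y := 1 / m * (1 / 3 * (m - 1) * (m + 1) + (y + 1) * (m - y))

lemma isTourPair_sym (hm : 1 ≤ m) : IsTourPair m (1 / 2) (1 / 2) (symProb m) (symTime m) := by
  have h0 : (m : ℝ) ≠ 0 := by positivity
  constructor
  · constructor
    · intro y; simp [symProb, Potential.zero]; norm_num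
    · intro y; simp [symProb, Potential.zero]; ring
    · intro y; simp [symProb, Potential.zero]; ring
    · intro y; simp [symProb, Potential.zero]; ring
    all_goals simp [symProb]
    all_goals omega
  · constructor
    · refine (firstStep_cubic m (m - 1) (-1) 0).congr (fun y => ?_) (fun y => ?_)
      · simp only [symTime]
        ring
      · simp [symProb]
    · refine (firstStep_cubic (1 + m / 3 - 1 / (3 * m)) (1 + m / 3 - 3 / (3 * m)) (-3 / (3 * m))
        (-1 / (3 * m))).congr (fun y => ?_) (fun y => ?_) <;>
        simp only [symProb, symTime] <;> field_simp <;> ring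
    · refine (firstStep_cubic (m * (1 + m / 3) - m ^ 2 / 3) (-(1 + m / 3) + m)
        (-1) (1 / (3 * m))).congr (fun y => ?_) (fun y => ?_)
      · simp only [symTime]; field_simp; ring
      · simp only [symProb]; field_simp
    · refine (firstStep_cubic (1 / m * (1 / 3 * (m - 1) * (m + 1) + m)) (1 / m * (m - 1))
        (-1 / m) 0).congr (fun y => ?_) (fun y => ?_) <;>
        simp only [symProb, symTime] <;> field_simp <;> ring
    all_goals simp [symTime]; field_simp; ring
  all_goals simp [symProb, symTime]

/-- The probability of the tour for the walk with ratio `r ≠ 1`. -/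
noncomputable def expProb (m : ℕ) (r : ℝ) : Potential where
  both := 1
  left y := (r ^ (y + 1) - 1) / (r ^ m - 1)
  right y := (r ^ m - r ^ y) / (r ^ m - 1)
  none y := r ^ y * ((r - 1) / (r ^ m - 1))

/-- The expectation of the exit time on the event of the tour for the walk with ratio `r ≠ 1`. -/
noncomputable def expTime (m : ℕ) (r : ℝ) : Potential where
  both y := (r + 1) / (r - 1) * (y + 1 - (m + 1) * ((r ^ (y + 1) - 1) / (r ^ (m + 1) - 1)))
  left y := (r + 1) / (r - 1) * (-(y + 1) * (r ^ (y + 1) + 1) / (r ^ m - 1) +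
    (2 * m * r ^ m / (r ^ m - 1) ^ 2 - (m + 1) / (r ^ (m + 1) - 1)) * (r ^ (y + 1) - 1))
  right y := (r + 1) / (r - 1) * ((r ^ m * (y - m) + y * r ^ y - m * r ^ m) / (r ^ m - 1) -
    (1 - (m + 1) * (r - 1) / (r ^ (m + 1) - 1) + 2 * m * r ^ m / (r ^ m - 1)) *
      ((r ^ y - r ^ m) / (r ^ m - 1)))
  none y := (r + 1) / (r - 1) * ((r - 1) / (r ^ m - 1) *
    (r ^ y * (2 * m - y - 1 - 2 / (r - 1) + 2 * m / (r ^ m - 1)) -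
      (m + 1) * ((r ^ m - r ^ y) / (r ^ (m + 1) - 1))))

lemma pow_ne_one_of_pos {r : ℝ} (hr : 0 < r) (hr1 : r ≠ 1) {n : ℕ} (hn : n ≠ 0) : r ^ n ≠ 1 :=
  fun h => hr1 ((pow_eq_one_iff_of_nonneg hr.le hn).1 h)

/-- The coefficients passed to `firstStep_exp` are those of the expansion of each branch in
`1`, `y`, `r ^ y`, `y r ^ y`. -/
lemma isTourPair_exp {r : ℝ} (hr : 0 < r) (hr1 : r ≠ 1) (hm : 1 ≤ m) :
    IsTourPair m (1 / (r + 1)) (r / (r + 1)) (expProb m r) (expTime m r) := by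
  have h1 : r + 1 ≠ 0 := by positivity
  have h2 : r - 1 ≠ 0 := sub_ne_zero.2 hr1
  have h3 : r ^ m - 1 ≠ 0 := sub_ne_zero.2 (pow_ne_one_of_pos hr hr1 (by omega))
  have h4 : r ^ (m + 1) - 1 ≠ 0 := sub_ne_zero.2 (pow_ne_one_of_pos hr hr1 (by omega))
  have hr0 := hr.ne'
  have hz : ∀ y : ℤ, r ^ (y + 1) = r ^ y * r := fun y => zpow_add_one₀ hr0 y
  have hzm : r ^ ((m : ℤ) - 1) = r ^ m / r := by
    rw [zpow_sub_one₀ hr0, zpow_natCast, div_eq_mul_inv]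
  rw [pow_succ] at h4
  have hR0 : r ^ m ≠ 0 := by positivity
  constructor
  · constructor
    · refine (firstStep_exp hr 1 0 0 0).congr (fun y => ?_) (fun y => ?_) <;>
        simp [expProb, Potential.zero]
    · refine (firstStep_exp hr (-1 / (r ^ m - 1)) 0 (r / (r ^ m - 1)) 0).congr
        (fun y => ?_) (fun y => ?_) <;> simp [expProb, Potential.zero, hz]
      field_simp
      ring
    · refine (firstStep_exp hr (r ^ m / (r ^ m - 1)) 0 (-1 / (r ^ m - 1)) 0).congr
        (fun y => ?_) (fun y => ?_) <;> simp [expProb, Potential.zero]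
      field_simp
      ring
    · refine (firstStep_exp hr 0 0 ((r - 1) / (r ^ m - 1)) 0).congr
        (fun y => ?_) (fun y => ?_) <;> simp [expProb, Potential.zero, mul_comm]
    · simp [expProb, div_self h3]
    · simp [expProb, div_self h3]
    · simp [expProb]
    · simp only [expProb, hzm]; field_simp
  · have k1 : ∀ x : ℝ, (r - 1) / (r + 1) * ((r + 1) / (r - 1) * x) = x := by
      intro x; field_simp
    generalize hR : r ^ m = R at *
    constructor
    · refine (firstStep_exp hr ((r + 1) / (r - 1) * (1 + (m + 1) / (R * r - 1)))
        ((r + 1) / (r - 1)) ((r + 1) / (r - 1) * (-(m + 1) * r / (R * r - 1))) 0).congr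
        (fun y => ?_) (fun y => ?_)
      · simp only [expTime, hz, pow_succ, hR]; field_simp; ring
      · simp only [expProb, Pi.one_apply]; field_simp; ring
    · refine (firstStep_exp hr
        ((r + 1) / (r - 1) * (-1 / (R - 1) - (2 * m * R / (R - 1) ^ 2 - (m + 1) / (R * r - 1))))
        ((r + 1) / (r - 1) * (-1 / (R - 1)))
        ((r + 1) / (r - 1) * (-r / (R - 1) +
          (2 * m * R / (R - 1) ^ 2 - (m + 1) / (R * r - 1)) * r))
        ((r + 1) / (r - 1) * (-r / (R - 1)))).congr (fun y => ?_) (fun y => ?_)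
      · simp only [expTime, hz, pow_succ, hR]; field_simp; ring
      · simp only [expProb, hz, hR]; field_simp; ring
    · refine (firstStep_exp hr
        ((r + 1) / (r - 1) * (-2 * m * R / (R - 1) +
          (1 - (m + 1) * (r - 1) / (R * r - 1) + 2 * m * R / (R - 1)) * R / (R - 1)))
        ((r + 1) / (r - 1) * (R / (R - 1)))
        ((r + 1) / (r - 1) *
          (-(1 - (m + 1) * (r - 1) / (R * r - 1) + 2 * m * R / (R - 1)) / (R - 1)))
        ((r + 1) / (r - 1) * (1 / (R - 1)))).congr (fun y => ?_) (fun y => ?_)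
      · simp only [expTime, hz, pow_succ, hR]; field_simp; ring
      · simp only [expProb, hz, hR]; field_simp
    · refine (firstStep_exp hr
        ((r + 1) / (r - 1) * ((r - 1) / (R - 1) * (-(m + 1) * R / (R * r - 1)))) 0
        ((r + 1) / (r - 1) * ((r - 1) / (R - 1) * (2 * m - 1 - 2 / (r - 1) + 2 * m / (R - 1) +
          (m + 1) / (R * r - 1))))
        ((r + 1) / (r - 1) * ((r - 1) / (R - 1) * (-1)))).congr (fun y => ?_) (fun y => ?_)
      · simp only [expTime, hz, pow_succ, hR]; field_simp; ring
      · simp only [expProb, hz, hR]; field_simp; ring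
    · simp only [expTime, hz, hzm, pow_succ, hR]; push_cast; field_simp; ring
    · simp only [expTime, hz, pow_succ, hR]; push_cast; simp only [zpow_zero]; field_simp; ring
    · simp only [expTime, hz, pow_succ, hR]; push_cast; simp only [zpow_zero]; field_simp; ring
    · simp only [expTime, hz, hzm, pow_succ, hR]; push_cast; field_simp; ring
  · rfl
  · simp [expProb]
  · simp [expProb]
  · simp [expTime]
  · have e : r ^ ((m : ℤ) + 1) = r ^ (m + 1) := by rw [← zpow_natCast]; push_cast; rfl
    simp [expTime, e, pow_succ, div_self h4]
  · simp [expTime]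
  · simp only [expTime, zpow_natCast, Int.cast_natCast]; ring

end

/-! ### The expectation of the cover time -/

section

variable {Ω : Type*}

variable [MeasurableSpace Ω] {μ : Measure Ω} {m : ℕ} {p q : ℝ} {ξ : ℕ → Ω → ℤ}

lemma IsWalk.expectedCoverTime_cond [IsProbabilityMeasure μ] (hw : IsWalk μ p q ξ)
    {h g : Potential} (H : IsTourPair m p q h g) {i : ℕ} (hi : 1 ≤ i) (him : i ≤ m)
    (hpos : 0 < h.none (m - i)) :
    0 < μ (lastVisited m ξ (i : ZMod (m + 1))) ∧
    expectedCoverTime m ξ (μ[|lastVisited m ξ (i : ZMod (m + 1))]) ≠ ∞ ∧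
    (expectedCoverTime m ξ (μ[|lastVisited m ξ (i : ZMod (m + 1))])).toReal =
      g.none (m - i) / h.none (m - i) := by
  obtain ⟨h1, h2, h3⟩ := hw.measure_lastVisited H hi him
  have hμ : 0 < μ (lastVisited m ξ (i : ZMod (m + 1))) := by
    rw [h1]; exact ENNReal.ofReal_pos.2 hpos
  have e : expectedCoverTime m ξ (μ[|lastVisited m ξ (i : ZMod (m + 1))]) =
      (ENNReal.ofReal (h.none (m - i)))⁻¹ * ENNReal.ofReal (g.none (m - i)) := by
    rw [expectedCoverTime, ProbabilityTheory.cond, lintegral_smul_measure, h1, h2, smul_eq_mul]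
  refine ⟨hμ, ?_, ?_⟩
  · rw [e]
    exact ENNReal.mul_ne_top (ENNReal.inv_ne_top.2 (ENNReal.ofReal_pos.2 hpos).ne')
      ENNReal.ofReal_ne_top
  · rw [e, ENNReal.toReal_mul, ENNReal.toReal_inv, ENNReal.toReal_ofReal hpos.le,
      ENNReal.toReal_ofReal h3, div_eq_inv_mul]

/-- If the probabilities of the events `L_i` sum to `1`, the expectation of the cover time is the
sum of the contributions of these events. -/
lemma IsWalk.expectedCoverTime_eq_sum [IsProbabilityMeasure μ] (hw : IsWalk μ p q ξ)
    {h g : Potential} (H : IsTourPair m p q h g) (hnn : ∀ j < m, 0 ≤ h.none (j : ℕ))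
    (hsum : ∑ j ∈ Finset.range m, h.none j = 1) :
    expectedCoverTime m ξ μ ≠ ∞ ∧
      (expectedCoverTime m ξ μ).toReal = ∑ j ∈ Finset.range m, g.none j := by
  -- Summation over the starting site `j = m - i` of the lift in place of the vertex `i`.
  set L : ℕ → Set Ω := fun j => lastVisited m ξ ((m - j : ℕ) : ZMod (m + 1)) with hL
  have hLm : ∀ j ∈ Finset.range m, MeasurableSet (L j) := fun j _ =>
    measurableSet_lastVisited hw.meas _
  have key : ∀ j ∈ Finset.range m, μ (L j) = ENNReal.ofReal (h.none j) ∧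
      ∫⁻ ω in L j, (coverTime m ξ ω : ℝ≥0∞) ∂μ = ENNReal.ofReal (g.none j) ∧ 0 ≤ g.none j := by
    intro j hj
    have hj := Finset.mem_range.1 hj
    have := hw.measure_lastVisited H (i := m - j) (by omega) (by omega)
    have e : (m : ℤ) - ((m - j : ℕ) : ℤ) = j := by omega
    rw [e] at this
    exact this
  have hdisj : Set.PairwiseDisjoint (↑(Finset.range m)) L := by
    intro a ha b hb hab
    have ha := Finset.mem_range.1 ha
    have hb := Finset.mem_range.1 hb
    refine disjoint_lastVisited ξ fun he => ?_
    rw [ZMod.natCast_eq_natCast_iff'] at he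
    rw [Nat.mod_eq_of_lt (by omega), Nat.mod_eq_of_lt (by omega)] at he
    omega
  have hfull : μ (⋃ j ∈ Finset.range m, L j) = 1 := by
    rw [measure_biUnion_finset hdisj hLm, Finset.sum_congr rfl fun j hj => (key j hj).1,
      ← ENNReal.ofReal_sum_of_nonneg fun j hj => hnn j (Finset.mem_range.1 hj), hsum,
      ENNReal.ofReal_one]
  have hms : MeasurableSet (⋃ j ∈ Finset.range m, L j) := Finset.measurableSet_biUnion _ hLm
  have e : expectedCoverTime m ξ μ = ENNReal.ofReal (∑ j ∈ Finset.range m, g.none j) := by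
    have hrestr : μ.restrict (⋃ j ∈ Finset.range m, L j) = μ :=
      Measure.restrict_eq_self_of_ae_mem ((mem_ae_iff_prob_eq_one hms).2 hfull)
    rw [expectedCoverTime, ← hrestr,
      lintegral_biUnion_finset hdisj hLm, Finset.sum_congr rfl fun j hj => (key j hj).2.1,
      ENNReal.ofReal_sum_of_nonneg fun j hj => (key j hj).2.2]
  rw [e]
  exact ⟨ENNReal.ofReal_ne_top,
    ENNReal.toReal_ofReal (Finset.sum_nonneg fun j hj => (key j hj).2.2)⟩

lemma sum_mul_pow {r : ℝ} (hr1 : r ≠ 1) (n : ℕ) :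
    ∑ j ∈ Finset.range n, (j : ℝ) * r ^ j =
      n * r ^ n / (r - 1) - r * (r ^ n - 1) / (r - 1) ^ 2 := by
  have h : r - 1 ≠ 0 := sub_ne_zero.2 hr1
  induction n with
  | zero => simp
  | succ n ih =>
    rw [Finset.sum_range_succ, ih]
    push_cast
    field_simp
    ring

lemma sum_symTime (hm : 1 ≤ m) :
    ∑ j ∈ Finset.range m, (symTime m).none j = (m : ℝ) * (m + 1) / 2 := by
  have h0 : (m : ℝ) ≠ 0 := by positivity
  have h : ∀ n : ℕ, ∑ j ∈ Finset.range n, (symTime m).none j =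
      1 / m * (n * (1 / 3 * (m - 1) * (m + 1) + m) + (m - 1) * (n * (n - 1) / 2) -
        (n - 1) * n * (2 * n - 1) / 6) := by
    intro n
    induction n with
    | zero => simp
    | succ n ih =>
      rw [Finset.sum_range_succ, ih]
      simp only [symTime]
      push_cast
      field_simp
      ring
  rw [h]
  field_simp
  ring

lemma sum_expTime {r : ℝ} (hr : 0 < r) (hr1 : r ≠ 1) (hm : 1 ≤ m) :
    ∑ j ∈ Finset.range m, (expTime m r).none j =
      (r + 1) / (r - 1) * ((m : ℝ) - 1 / (r - 1) - (m : ℝ) ^ 2 / (r ^ m - 1)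
        + ((m : ℝ) + 1) ^ 2 / (r ^ (m + 1) - 1)) := by
  have h1 : r + 1 ≠ 0 := by positivity
  have h2 : r - 1 ≠ 0 := sub_ne_zero.2 hr1
  have h3 : r ^ m - 1 ≠ 0 := sub_ne_zero.2 (pow_ne_one_of_pos hr hr1 (by omega))
  have h4 : r ^ (m + 1) - 1 ≠ 0 := sub_ne_zero.2 (pow_ne_one_of_pos hr hr1 (by omega))
  have e : ∀ j : ℕ, (expTime m r).none j = (r + 1) / (r - 1) * ((r - 1) / (r ^ m - 1)) *
      (2 * m - 1 - 2 / (r - 1) + 2 * m / (r ^ m - 1) + (m + 1) / (r ^ (m + 1) - 1)) * r ^ j -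
      (r + 1) / (r - 1) * ((r - 1) / (r ^ m - 1)) * ((j : ℝ) * r ^ j) -
      (r + 1) / (r - 1) * ((r - 1) / (r ^ m - 1)) *
        ((m + 1) * (r ^ m / (r ^ (m + 1) - 1))) := by
    intro j
    simp only [expTime, zpow_natCast, Int.cast_natCast]
    ring
  simp only [e, Finset.sum_sub_distrib, ← Finset.mul_sum, sum_mul_pow hr1, geom_sum_eq hr1,
    Finset.sum_const, Finset.card_range, nsmul_eq_mul]
  have hQ : r ^ (m + 1) = r ^ m * r := pow_succ r m
  clear e
  generalize r ^ (m + 1) = Q at *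
  generalize r ^ m = R at *
  field_simp
  rw [hQ]
  ring

end

end PolygonWalk

open PolygonWalk

theorem theorem3p3 {Ω : Type*} [MeasurableSpace Ω] (μ : Measure Ω) [IsProbabilityMeasure μ]
    (m : ℕ) (hm : 1 ≤ m) (p q r : ℝ) (hp0 : 0 < p) (hp1 : p < 1) (hq : q = 1 - p) (hr : r = q / p)
    (ξ : ℕ → Ω → ℤ) (hmeas : ∀ n, Measurable (ξ n)) (hindep : iIndepFun ξ μ)
    (hcw : ∀ n, μ {ω | ξ n ω = 1} = ENNReal.ofReal p)
    (hccw : ∀ n, μ {ω | ξ n ω = -1} = ENNReal.ofReal q) :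
    (∀ i : ℕ, 1 ≤ i → i ≤ m →
      0 < μ (PolygonWalk.lastVisited m ξ (i : ZMod (m + 1))) ∧
      PolygonWalk.expectedCoverTime m ξ (μ[|PolygonWalk.lastVisited m ξ (i : ZMod (m + 1))]) ≠ ∞ ∧
      (PolygonWalk.expectedCoverTime m ξ
          (μ[|PolygonWalk.lastVisited m ξ (i : ZMod (m + 1))])).toReal =
        if r = 1 then
          (1 / 3 : ℝ) * ((m : ℝ) - 1) * ((m : ℝ) + 1) + ((m : ℝ) + 1 - (i : ℝ)) * (i : ℝ)
        else
          (r + 1) / (r - 1) *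
            ((m : ℝ) + (i : ℝ) - 1 - 2 / (r - 1) + 2 * (m : ℝ) / (r ^ m - 1)
              - ((m : ℝ) + 1) * ((r ^ i - 1) / (r ^ (m + 1) - 1)))) ∧
    PolygonWalk.expectedCoverTime m ξ μ ≠ ∞ ∧
    (PolygonWalk.expectedCoverTime m ξ μ).toReal =
      if r = 1 then
        (m : ℝ) * ((m : ℝ) + 1) / 2
      else
        (r + 1) / (r - 1) *
          ((m : ℝ) - 1 / (r - 1) - (m : ℝ) ^ 2 / (r ^ m - 1)
            + ((m : ℝ) + 1) ^ 2 / (r ^ (m + 1) - 1)) := by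
  have hq0 : 0 < q := by linarith
  have hr0 : 0 < r := hr ▸ div_pos hq0 hp0
  have hw : IsWalk μ p q ξ := ⟨hp0.le, hq0.le, by linarith, hmeas, hindep, hcw, hccw⟩
  have hsum : r + 1 = 1 / p := by rw [hr, hq]; field_simp; ring
  have hp : p = 1 / (r + 1) := by rw [hsum, one_div_one_div]
  have hq' : q = r / (r + 1) := by rw [hsum, hr]; field_simp
  have hm0 : (0 : ℝ) < m := by exact_mod_cast hm
  by_cases hr1 : r = 1
  · simp only [if_pos hr1]
    have H : IsTourPair m p q (symProb m) (symTime m) := by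
      have := isTourPair_sym hm
      rw [hp, hq', hr1]
      norm_num at this ⊢
      exact this
    refine ⟨fun i hi him => ?_, ?_⟩
    · obtain ⟨h1, h2, h3⟩ := hw.expectedCoverTime_cond H hi him (one_div_pos.2 hm0)
      refine ⟨h1, h2, h3.trans ?_⟩
      simp only [symProb, symTime]
      push_cast
      field_simp
      ring
    · have h := hw.expectedCoverTime_eq_sum H (fun j _ => (one_div_pos.2 hm0).le)
        (by simp [symProb, hm0.ne'])
      rwa [sum_symTime hm] at h
  · simp only [if_neg hr1]
    have H : IsTourPair m p q (expProb m r) (expTime m r) := by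
      rw [hp, hq']
      exact isTourPair_exp hr0 hr1 hm
    have h2 : r - 1 ≠ 0 := sub_ne_zero.2 hr1
    have h3 : r ^ m - 1 ≠ 0 := sub_ne_zero.2 (pow_ne_one_of_pos hr0 hr1 (by omega))
    have h4 : r ^ (m + 1) - 1 ≠ 0 := sub_ne_zero.2 (pow_ne_one_of_pos hr0 hr1 (by omega))
    have hratio : 0 < (r - 1) / (r ^ m - 1) := by
      rcases lt_or_gt_of_ne hr1 with h | h
      · exact div_pos_of_neg_of_neg (by linarith)
          (by linarith [pow_lt_one₀ hr0.le h (n := m) (by omega)])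
      · exact div_pos (by linarith) (by linarith [one_lt_pow₀ h (n := m) (by omega)])
    have hpos : ∀ j : ℤ, 0 < (expProb m r).none j := fun j => mul_pos (zpow_pos hr0 j) hratio
    refine ⟨fun i hi him => ?_, ?_⟩
    · obtain ⟨e1, e2, e3⟩ := hw.expectedCoverTime_cond H hi him (hpos _)
      refine ⟨e1, e2, e3.trans ?_⟩
      have hi0 : r ^ i ≠ 0 := by positivity
      have ez : r ^ ((m : ℤ) - i) = r ^ m / r ^ i := by
        rw [zpow_sub₀ hr0.ne', zpow_natCast, zpow_natCast]
      have hR0 : r ^ m ≠ 0 := by positivity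
      simp only [expProb, expTime, ez]
      push_cast
      generalize r ^ (m + 1) = Q at *
      generalize r ^ m = R at *
      field_simp
      ring
    · have h := hw.expectedCoverTime_eq_sum H (fun j _ => (hpos j).le) (by
        simp only [expProb, zpow_natCast, ← Finset.sum_mul, geom_sum_eq hr1]
        field_simp)
      rwa [sum_expTime hr0 hr1 hm] at h
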